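/- A (unitary, two-qubit) matchgate is a two-qubit gate that acts as some $A\in SU(2)$ on the span of $|00\rangle,|11\rangle$ and as some $B\in SU(2)$ on the span of $|01\rangle,|10\rangle$. A nearest-neighbor matchgate circuit is a finite sequence of matchgates, each applied to two neighboring qubits $j,j+1$ of a line of $M$ qubits. Call a family of functions $f_n:\{0,1\}^n\to\{0,1\}$ $(n=1,2,\dots)$ efficiently matchgate-computable if there are $M_n\ge n$, bounded by a polynomial in $n$, and nearest-neighbor matchgate circuits $U_n$ on $M_n$ qubits, with $U_n$ depending only on $n$, such that (i) for every $n\geq 1$ and every $x\in\{0,1\}^n$, applying $U_n$ to $|x\rangle|0\rangle^{M_n-n}$ and then measuring the first qubit in the computational basis yields the outcome $f_n(x)$ with probability at least $2/3$; (ii) the family is polynomial-time uniform: a Turing machine, given $n$ and $m$ in unary, outputs in time polynomial in $n+m$ the number $M_n$ and the list of the gates of $U_n$, each with its position and with the entries of its matrices $A,B$ as dyadic rational numbers with denominator $2^m$, the real and the imaginary part of each entry being within $2^{-m}$ of its true value. Theorem. There exists a family of functions $f_n:\{0,1\}^n\to\{0,1\}$ that is computable in polynomial time by a deterministic Turing machine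 (i.e. is in P) and that is not efficiently matchgate-computable. -/

import Mathlib

namespace MatchgateCircuit

/-! ## Functions in P -/

/-- The family `f n : {0,1}ⁿ → {0,1}` is computable in polynomial time: one Turing machine, given an
`n`-bit string (for any `n`) as its input word, outputs the bit `f n x` after a number of steps that
is bounded by a polynomial in `n`. -/
def InP (f : (n : ℕ) → (Fin n → Bool) → Bool) : Prop :=
  Nonempty (Turing.TM2ComputableInPolyTime (Computability.encodingList Bool).encode
    Computability.encodeBool (fun w : List Bool => f w.length w.get))

/-! ## Nearest-neighbour matchgate circuits -/

/-- The two-qubit gate that acts as `A` on the span of `|00⟩, |11⟩` and as `B` on the span of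
`|01⟩, |10⟩`. Its rows and columns are indexed by the values of the two qubits, `false` standing for
`0` and `true` for `1`; in the even subspace `|pp⟩` has index `p`, in the odd one
`|p (1-p)⟩` has index `p`. -/
def matchgate (A B : Matrix Bool Bool ℂ) : Matrix (Bool × Bool) (Bool × Bool) ℂ :=
  Matrix.of fun y x =>
    if y.1 = y.2 ∧ x.1 = x.2 then A y.1 x.1
    else if y.1 ≠ y.2 ∧ x.1 ≠ x.2 then B y.1 x.1
    else 0

/-- The operator on `M` qubits that applies the two-qubit gate `G` to the ordered pair of qubits
`(j, k)` and the identity to all other qubits, as a matrix in the computational basis. -/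
def actOn {M : ℕ} (j k : Fin M) (G : Matrix (Bool × Bool) (Bool × Bool) ℂ) :
    Matrix (Fin M → Bool) (Fin M → Bool) ℂ :=
  Matrix.of fun y x =>
    if ∀ i, i ≠ j → i ≠ k → y i = x i then G (y j, y k) (x j, x k) else 0

/-- A matchgate on the neighbouring qubits `pos` and `pos + 1` of a line of `M` qubits, given by two
matrices in `SU(2)`. -/
structure Gate (M : ℕ) where
  pos : ℕ
  pos_lt : pos + 1 < M
  even : Matrix.specialUnitaryGroup Bool ℂ
  odd : Matrix.specialUnitaryGroup Bool ℂ

/-- The operator on `M` qubits implemented by a gate. -/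
def Gate.operator {M : ℕ} (g : Gate M) : Matrix (Fin M → Bool) (Fin M → Bool) ℂ :=
  actOn ⟨g.pos, (Nat.lt_succ_self _).trans g.pos_lt⟩ ⟨g.pos + 1, g.pos_lt⟩
    (matchgate (g.even : Matrix Bool Bool ℂ) (g.odd : Matrix Bool Bool ℂ))

/-- A nearest-neighbour matchgate circuit on `M` qubits: its gates in the order of application. -/
abbrev Circuit (M : ℕ) := List (Gate M)

/-- The operator implemented by a circuit; the head of the list acts first. -/
def Circuit.operator {M : ℕ} : Circuit M → Matrix (Fin M → Bool) (Fin M → Bool) ℂ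
  | [] => 1
  | g :: C => Circuit.operator C * g.operator

/-- The `M`-bit string `x 0 ⋯ 0`. -/
def pad {n : ℕ} (M : ℕ) (x : Fin n → Bool) : Fin M → Bool :=
  fun i => if h : (i : ℕ) < n then x ⟨i, h⟩ else false

/-- The probability that measuring qubit `i` in the computational basis yields `b`, after the
circuit `C` was applied to the basis state `|z⟩`. -/
noncomputable def outcomeProb {M : ℕ} (C : Circuit M) (z : Fin M → Bool) (i : Fin M) (b : Bool) :
    ℝ :=
  ∑ y : Fin M → Bool, if y i = b then ‖C.operator y z‖ ^ 2 else 0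

/-! ## Classical descriptions of circuits and uniformity -/

/-- A finite description of a gate: its position, and for every entry of its two matrices the
numerators of two dyadic rationals, which stand for the real and the imaginary part. The common
denominator `2 ^ m` is not part of the data. -/
structure GateDesc where
  pos : ℕ
  even : Bool → Bool → ℤ × ℤ
  odd : Bool → Bool → ℤ × ℤ

/-- A finite description of a circuit: the number of qubits and the list of gates. -/
structure CircuitDesc where
  qubits : ℕ
  gates : List GateDesc

/-- The complex number with numerators `q` approximates `c` to `m` bits. -/
def Approx (m : ℕ) (q : ℤ × ℤ) (c : ℂ) : Prop :=
  |c.re - (q.1 : ℝ) / 2 ^ m| ≤ 1 / 2 ^ m ∧ |c.im - (q.2 : ℝ) / 2 ^ m| ≤ 1 / 2 ^ m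

/-- `d` describes the gate `g`, with all matrix entries correct to `m` bits. -/
def GateDesc.Describes {M : ℕ} (m : ℕ) (d : GateDesc) (g : Gate M) : Prop :=
  d.pos = g.pos ∧
    (∀ i j, Approx m (d.even i j) ((g.even : Matrix Bool Bool ℂ) i j)) ∧
    (∀ i j, Approx m (d.odd i j) ((g.odd : Matrix Bool Bool ℂ) i j))

/-- `d` describes the circuit `C`, gate by gate, with all matrix entries correct to `m` bits. -/
def CircuitDesc.Describes {M : ℕ} (m : ℕ) (d : CircuitDesc) (C : Circuit M) : Prop :=
  d.qubits = M ∧ List.Forall₂ (GateDesc.Describes m) d.gates C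

/-- An integer as a word: a sign bit, the absolute value in binary, and a comma. -/
def encodeInt (z : ℤ) : List Computability.Γ' :=
  .bit (decide (z < 0)) :: ((Computability.encodeNat z.natAbs).map .bit ++ [.comma])

/-- The four entries of a two by two matrix of numerators, row by row. -/
def entries (q : Bool → Bool → ℤ × ℤ) : List ℤ :=
  [(q false false).1, (q false false).2, (q false true).1, (q false true).2,
    (q true false).1, (q true false).2, (q true true).1, (q true true).2]

/-- The seventeen integers that make up the description of a gate. -/
def GateDesc.toInts (d : GateDesc) : List ℤ :=
  (d.pos : ℤ) :: (entries d.even ++ entries d.odd)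

/-- A circuit description as a word over a finite alphabet: the number of qubits, followed by the
integers of all gates. -/
def CircuitDesc.encode (d : CircuitDesc) : List Computability.Γ' :=
  ((d.qubits : ℤ) :: d.gates.flatMap GateDesc.toInts).flatMap encodeInt

/-- The circuit family `U` is polynomial-time uniform: some Turing machine outputs, on input
`(n, m)` in unary, a description of `U n` with all matrix entries correct to `m` bits, in time
polynomial in `n + m`. -/
def Uniform {M : ℕ → ℕ} (U : (n : ℕ) → Circuit (M n)) : Prop :=
  ∃ D : ℕ × ℕ → CircuitDesc,
    Nonempty (Turing.TM2ComputableInPolyTime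
      (Computability.encodingProd Computability.unaryEncodingNat
        Computability.unaryEncodingNat).encode
      CircuitDesc.encode D) ∧
    ∀ n, 1 ≤ n → ∀ m, (D (n, m)).Describes m (U n)

/-- The family `f n : {0,1}ⁿ → {0,1}`, `n = 1, 2, …`, is efficiently matchgate-computable: there is
a polynomial-time uniform family of nearest-neighbour matchgate circuits `U n` on `M n = poly(n)`
qubits such that `U n`, applied to `|x⟩|0⟩^(M n - n)` and followed by a measurement of the first
qubit, yields `f n x` with probability at least `2/3`, for every `n`-bit string `x`. -/
def EfficientlyMatchgateComputable (f : (n : ℕ) → (Fin n → Bool) → Bool) : Prop :=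
  ∃ (M : ℕ → ℕ) (hM : ∀ n, 1 ≤ n → n ≤ M n) (U : (n : ℕ) → Circuit (M n)),
    (∃ p : Polynomial ℕ, ∀ n, 1 ≤ n → M n ≤ p.eval n) ∧
    Uniform U ∧
    ∀ (n : ℕ) (hn : 1 ≤ n) (x : Fin n → Bool),
      2 / 3 ≤ outcomeProb (U n) (pad (M n) x) ⟨0, hn.trans (hM n hn)⟩ (f n x)

end MatchgateCircuit

/-!
The witness is the parity function. It is read off by a one-stack machine in linear time; that no
matchgate circuit computes it, uniform or not, is due to the free-fermion structure of matchgates.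

Conjugation by a nearest-neighbour matchgate with blocks in `SU(2)` maps each Majorana
(Jordan–Wigner) operator to a linear combination of Majorana operators
(`exists_majorana_mul_operator`). For the qubits the gate does not touch, the operator commutes with
the gate, which preserves the parity of the two qubits it acts on. For the two touched qubits, the
span of the four Majorana operators is, up to a common Jordan–Wigner string, the space of 4×4
matrices that swap the even and the odd subspace by blocks `P` and `-adj P`. If the gate acts by `A`
and `B`, conjugation replaces `P` by `A⁻¹ P B` and `adj P` by
`B⁻¹ (adj P) A = adj (A⁻¹ P B)`, so the space is preserved; `det A = det B = 1` enters here.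

The observable `Z` on a qubit is a product of two Majorana operators, hence for a circuit `C` the
operator `C† Z C` is a combination of products of two. The diagonal entry at `x` of such a product
is a constant or a multiple of `(-1) ^ x i` for one `i`. Therefore the bias of the measured bit is
an affine function of the signs of the input bits (`exists_outcomeProb_eq_affine`). An affine
function `d` of two signs satisfies `d 00 + d 11 = d 01 + d 10`, which is incompatible with the
bias of a circuit for the parity of two bits.
-/

namespace MatchgateCircuit

open Matrix

/-- The sign `(-1) ^ b`. -/
def sgn (b : Bool) : ℂ := if b then -1 else 1

@[simp] lemma sgn_false : sgn false = 1 := rfl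
@[simp] lemma sgn_true : sgn true = -1 := rfl
@[simp] lemma sgn_not (b : Bool) : sgn (!b) = -sgn b := by cases b <;> simp
lemma sgn_mul_self (b : Bool) : sgn b * sgn b = 1 := by cases b <;> simp

/-! ### Two-qubit gates -/

lemma matchgate_mul (A B A' B' : Matrix Bool Bool ℂ) :
    matchgate A B * matchgate A' B' = matchgate (A * A') (B * B') := by
  ext ⟨a, b⟩ ⟨c, d⟩
  cases a <;> cases b <;> cases c <;> cases d <;>
    simp [matchgate, mul_apply, Fintype.sum_prod_type, add_comm]

lemma matchgate_one : matchgate 1 1 = 1 := by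
  ext ⟨a, b⟩ ⟨c, d⟩
  cases a <;> cases b <;> cases c <;> cases d <;> simp [matchgate, one_apply]

lemma matchgate_conjTranspose (A B : Matrix Bool Bool ℂ) :
    (matchgate A B)ᴴ = matchgate Aᴴ Bᴴ := by
  ext ⟨a, b⟩ ⟨c, d⟩
  cases a <;> cases b <;> cases c <;> cases d <;> simp [matchgate]

/-- The two-qubit operator that acts as `P` from the span of `|01⟩, |10⟩` to that of `|00⟩, |11⟩`
and as `Q` in the opposite direction, with the basis indexing of `matchgate`. -/
def oddGate (P Q : Matrix Bool Bool ℂ) : Matrix (Bool × Bool) (Bool × Bool) ℂ :=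
  Matrix.of fun y x =>
    if y.1 = y.2 ∧ x.1 ≠ x.2 then P y.1 x.1
    else if y.1 ≠ y.2 ∧ x.1 = x.2 then Q y.1 x.1
    else 0

lemma oddGate_mul_matchgate (P Q A B : Matrix Bool Bool ℂ) :
    oddGate P Q * matchgate A B = oddGate (P * B) (Q * A) := by
  ext ⟨a, b⟩ ⟨c, d⟩
  cases a <;> cases b <;> cases c <;> cases d <;>
    simp [matchgate, oddGate, mul_apply, Fintype.sum_prod_type, add_comm]

lemma matchgate_mul_oddGate (P Q A B : Matrix Bool Bool ℂ) :
    matchgate A B * oddGate P Q = oddGate (A * P) (B * Q) := by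
  ext ⟨a, b⟩ ⟨c, d⟩
  cases a <;> cases b <;> cases c <;> cases d <;>
    simp [matchgate, oddGate, mul_apply, Fintype.sum_prod_type, add_comm]

/-- The span of the four Majorana operators of two neighbouring qubits consists of the operators
`majoranaGate P`; it is invariant under conjugation by a matchgate because the adjugate reverses
products and inverts the elements of `SU(2)`. -/
def majoranaGate (P : Matrix Bool Bool ℂ) : Matrix (Bool × Bool) (Bool × Bool) ℂ :=
  oddGate P (-P.adjugate)

lemma majoranaGate_mul_matchgate (P A B : Matrix Bool Bool ℂ)
    (hA : A ∈ specialUnitaryGroup Bool ℂ) (hB : B ∈ specialUnitaryGroup Bool ℂ) :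
    majoranaGate P * matchgate A B
      = matchgate A B * majoranaGate (A.adjugate * P * B) := by
  have hA1 : A.det = 1 := (mem_specialUnitaryGroup_iff.1 hA).2
  have hB1 : B.det = 1 := (mem_specialUnitaryGroup_iff.1 hB).2
  have hadj : A.adjugate.adjugate = A := by
    rw [adjugate_adjugate' A]; simp [hA1]
  rw [majoranaGate, majoranaGate, oddGate_mul_matchgate, matchgate_mul_oddGate]
  congr 1
  · rw [← Matrix.mul_assoc, ← Matrix.mul_assoc, mul_adjugate, hA1, one_smul, Matrix.one_mul]
  · rw [adjugate_mul_distrib, adjugate_mul_distrib, hadj, Matrix.mul_neg, ← Matrix.mul_assoc,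
      mul_adjugate, hB1, one_smul, Matrix.one_mul, Matrix.neg_mul]

/-! ### Two-qubit gates acting on a line of qubits -/

variable {M : ℕ}

lemma actOn_mul {j k : Fin M} (hjk : j ≠ k) (G H : Matrix (Bool × Bool) (Bool × Bool) ℂ) :
    actOn j k G * actOn j k H = actOn j k (G * H) := by
  ext y x
  simp only [mul_apply, actOn, of_apply]
  by_cases h : ∀ i, i ≠ j → i ≠ k → y i = x i
  · rw [if_pos h]
    symm
    -- The summands vanish unless `z` agrees with `x` off `{j, k}`, so `z` is given by two bits.
    refine Fintype.sum_of_injective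
      (fun p : Bool × Bool => Function.update (Function.update x j p.1) k p.2) ?_ _ _ ?_ ?_
    · intro p q hpq
      have h1 := congrFun hpq j
      have h2 := congrFun hpq k
      simp [hjk] at h1 h2
      exact Prod.ext h1 h2
    · intro z hz
      rw [if_neg (c := ∀ i, i ≠ j → i ≠ k → z i = x i), mul_zero]
      intro hzx
      refine hz ⟨(z j, z k), funext fun i => ?_⟩
      by_cases hk : i = k
      · simp [hk]
      · by_cases hj : i = j
        · subst hj; simp [hk]
        · simp [hk, hj, hzx i hj hk]
    · intro p
      rw [if_pos, if_pos]
      · simp [hjk]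
      · intro i hj hk; simp [hj, hk]
      · intro i hj hk; simp [hj, hk, h i hj hk]
  · rw [if_neg h]
    refine Finset.sum_eq_zero fun z _ => ?_
    by_cases h1 : ∀ i, i ≠ j → i ≠ k → y i = z i
    · rw [if_neg (c := ∀ i, i ≠ j → i ≠ k → z i = x i), mul_zero]
      exact fun h2 => h fun i hj hk => (h1 i hj hk).trans (h2 i hj hk)
    · rw [if_neg h1, zero_mul]

lemma actOn_one (j k : Fin M) : actOn j k 1 = 1 := by
  ext y x
  simp only [actOn, of_apply, one_apply, Prod.mk.injEq, ← ite_and]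
  congr 1
  refine propext ⟨fun ⟨h, hj, hk⟩ => funext fun i => ?_, ?_⟩
  · by_cases h1 : i = j
    · exact h1 ▸ hj
    · by_cases h2 : i = k
      · exact h2 ▸ hk
      · exact h i h1 h2
  · rintro rfl; simp

lemma actOn_conjTranspose (j k : Fin M) (G : Matrix (Bool × Bool) (Bool × Bool) ℂ) :
    (actOn j k G)ᴴ = actOn j k Gᴴ := by
  ext y x
  simp only [actOn, conjTranspose_apply, of_apply, apply_ite star, star_zero, eq_comm]

lemma actOn_add (j k : Fin M) (G H : Matrix (Bool × Bool) (Bool × Bool) ℂ) :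
    actOn j k (G + H) = actOn j k G + actOn j k H := by
  ext y x
  simp only [actOn, of_apply, Matrix.add_apply]; split_ifs <;> simp

lemma actOn_smul (j k : Fin M) (c : ℂ) (G : Matrix (Bool × Bool) (Bool × Bool) ℂ) :
    actOn j k (c • G) = c • actOn j k G := by
  ext y x
  simp only [actOn, of_apply, Matrix.smul_apply]; split_ifs <;> simp

lemma Gate.conjTranspose_operator_mul_self (g : Gate M) : g.operatorᴴ * g.operator = 1 := by
  have hA : (g.even : Matrix Bool Bool ℂ)ᴴ * g.even = 1 :=
    (mem_unitaryGroup_iff'.1 (mem_specialUnitaryGroup_iff.1 g.even.2).1)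
  have hB : (g.odd : Matrix Bool Bool ℂ)ᴴ * g.odd = 1 :=
    (mem_unitaryGroup_iff'.1 (mem_specialUnitaryGroup_iff.1 g.odd.2).1)
  rw [Gate.operator, actOn_conjTranspose, actOn_mul (by simp [Fin.ext_iff]),
    matchgate_conjTranspose, matchgate_mul, hA, hB, matchgate_one, actOn_one]

lemma Circuit.conjTranspose_operator_mul_self (C : Circuit M) :
    (Circuit.operator C)ᴴ * Circuit.operator C = 1 := by
  induction C with
  | nil => simp [Circuit.operator]
  | cons g C ih =>
    rw [Circuit.operator, conjTranspose_mul, Matrix.mul_assoc, ← Matrix.mul_assoc _ _ g.operator,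
      ih, Matrix.one_mul, g.conjTranspose_operator_mul_self]

/-! ### Majorana operators -/

/-- The string `x` with bit `k` negated. -/
def flipBit (k : Fin M) (x : Fin M → Bool) : Fin M → Bool := Function.update x k (!x k)

@[simp] lemma flipBit_self (k : Fin M) (x : Fin M → Bool) : flipBit k x k = !x k := by
  simp [flipBit]

lemma flipBit_of_ne {k i : Fin M} (h : i ≠ k) (x : Fin M → Bool) : flipBit k x i = x i := by
  simp [flipBit, h]

@[simp] lemma flipBit_flipBit (k : Fin M) (x : Fin M → Bool) : flipBit k (flipBit k x) = x := by
  simp [flipBit]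

lemma eq_flipBit_iff (k : Fin M) (x y : Fin M → Bool) : y = flipBit k x ↔ x = flipBit k y :=
  ⟨fun h => by simp [h], fun h => by simp [h]⟩

/-- The phase that the Majorana operators of qubit `k` give to the basis state `|x⟩`. -/
def phase (k : Fin M) (s : Bool) (x : Fin M → Bool) : ℂ :=
  (∏ i with i < k, sgn (x i)) * if s then sgn (x k) else 1

/-- The two Majorana (Jordan–Wigner) operators of qubit `k`: `Z ⋯ Z X` for `s = false` and
`Z ⋯ Z (X Z)` for `s = true`. The usual `Z ⋯ Z Y` is the latter times `i`; only complex spans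
matter here. -/
def majorana (k : Fin M) (s : Bool) : Matrix (Fin M → Bool) (Fin M → Bool) ℂ :=
  Matrix.of fun y x => if y = flipBit k x then phase k s x else 0

lemma majorana_mul_apply (k : Fin M) (s : Bool) (W : Matrix (Fin M → Bool) (Fin M → Bool) ℂ)
    (y x : Fin M → Bool) : (majorana k s * W) y x = phase k s (flipBit k y) * W (flipBit k y) x := by
  simp [majorana, mul_apply, eq_flipBit_iff k _ y]

lemma mul_majorana_apply (k : Fin M) (s : Bool) (W : Matrix (Fin M → Bool) (Fin M → Bool) ℂ)
    (y x : Fin M → Bool) : (W * majorana k s) y x = W y (flipBit k x) * phase k s x := by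
  simp [majorana, mul_apply]

/-- The space of linear combinations of Majorana operators. -/
def majoranaSpan (M : ℕ) : Submodule ℂ (Matrix (Fin M → Bool) (Fin M → Bool) ℂ) :=
  Submodule.span ℂ (Set.range fun p : Fin M × Bool => majorana p.1 p.2)

lemma majorana_mem (k : Fin M) (s : Bool) : majorana k s ∈ majoranaSpan M :=
  Submodule.subset_span ⟨(k, s), rfl⟩

/-! ### Conjugation of Majorana operators by matchgates -/

/-- The Majorana operators of the qubits other than `j` and `k` commute with a matchgate acting on
`j` and `k`: the Jordan–Wigner string contains neither or both of `Z_j` and `Z_k`, and a matchgate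
preserves the parity of the two qubits. -/
lemma majorana_mul_actOn_of_ne {j k : Fin M} (hjk : (k : ℕ) = j + 1) {l : Fin M} (hj : l ≠ j)
    (hk : l ≠ k) (s : Bool) (A B : Matrix Bool Bool ℂ) :
    majorana l s * actOn j k (matchgate A B) = actOn j k (matchgate A B) * majorana l s := by
  ext y x
  rw [majorana_mul_apply, mul_majorana_apply]
  have hentry :
      actOn j k (matchgate A B) y (flipBit l x) = actOn j k (matchgate A B) (flipBit l y) x := by
    simp only [actOn, of_apply, flipBit_of_ne hj.symm, flipBit_of_ne hk.symm]
    congr 1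
    refine propext (forall₃_congr fun i _ _ => ?_)
    by_cases hi : i = l
    · subst hi; rw [flipBit_self, flipBit_self]; cases x i <;> cases y i <;> simp
    · rw [flipBit_of_ne hi, flipBit_of_ne hi]
  rw [hentry, mul_comm]
  generalize flipBit l y = z
  by_cases hz : ∀ i, i ≠ j → i ≠ k → z i = x i
  swap
  · simp [actOn, hz]
  by_cases hpar : sgn (z j) * sgn (z k) = sgn (x j) * sgn (x k)
  · congr 1
    rw [phase, phase, hz l hj hk]
    congr 1
    have hne : k ≠ j := by intro h; rw [h] at hjk; omega
    rcases lt_or_gt_of_ne hj with h | h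
    · refine Finset.prod_congr rfl fun i hi => ?_
      have hi : i < l := by simpa using hi
      rw [hz i (hi.trans h).ne]
      rintro rfl
      simp only [Fin.lt_def] at hi h
      omega
    · have hlk : k < l := by
        have : (l : ℕ) ≠ k := fun e => hk (Fin.ext e)
        simp only [Fin.lt_def] at h ⊢
        omega
      rw [← Finset.mul_prod_erase _ (fun i => sgn (z i)) (show j ∈ _ by simpa using h),
        ← Finset.mul_prod_erase _ (fun i => sgn (x i)) (show j ∈ _ by simpa using h),
        ← Finset.mul_prod_erase _ (fun i => sgn (z i))
          (Finset.mem_erase.2 ⟨hne, by simpa using hlk⟩),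
        ← Finset.mul_prod_erase _ (fun i => sgn (x i))
          (Finset.mem_erase.2 ⟨hne, by simpa using hlk⟩),
        ← mul_assoc, ← mul_assoc, hpar]
      congr 1
      refine Finset.prod_congr rfl fun i hi => ?_
      simp only [Finset.mem_erase] at hi
      rw [hz i hi.2.1 hi.1]
  · have h0 : actOn j k (matchgate A B) z x = 0 := by
      simp only [actOn, of_apply, if_pos hz, matchgate]
      revert hpar
      cases z j <;> cases z k <;> cases x j <;> cases x k <;> simp
    rw [h0, zero_mul, zero_mul]

/-- The product of the Pauli `Z` operators of the qubits before `j`. -/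
def jwString (j : Fin M) : Matrix (Fin M → Bool) (Fin M → Bool) ℂ :=
  diagonal fun x => ∏ i with i < j, sgn (x i)

lemma jwString_mul_actOn {j k : Fin M} (hjk : (k : ℕ) = j + 1)
    (G : Matrix (Bool × Bool) (Bool × Bool) ℂ) :
    jwString j * actOn j k G = actOn j k G * jwString j := by
  ext y x
  rw [jwString, diagonal_mul, mul_diagonal, mul_comm]
  by_cases h : ∀ i, i ≠ j → i ≠ k → y i = x i
  · congr 1
    refine Finset.prod_congr rfl fun i hi => ?_
    have hi : i < j := by simpa using hi
    rw [h i hi.ne]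
    rintro rfl
    simp only [Fin.lt_def] at hi
    omega
  · simp [actOn, h]

/-- The matrix `P` for which `majoranaGate P` is the Majorana operator `s` of the first or of the
second (`second = true`) of two qubits. -/
def majoranaCoeff (second s : Bool) : Matrix Bool Bool ℂ :=
  match second, s with
  | false, false => of fun y x => if y = x then 0 else 1
  | false, true => of fun y x => if y = x then 0 else sgn x
  | true, false => of fun y x => if y = x then sgn x else 0
  | true, true => -1

lemma adjugate_bool (P : Matrix Bool Bool ℂ) :
    P.adjugate = of fun y x => if y = x then P (!y) (!y) else -P y x := by
  ext y x
  rw [adjugate_apply, ← det_reindex_self finTwoEquiv.symm, det_fin_two]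
  cases y <;> cases x <;> simp [finTwoEquiv, updateRow_apply]

lemma majoranaGate_first_apply (s : Bool) (y x : Bool × Bool) :
    majoranaGate (majoranaCoeff false s) y x =
      if y.1 = !x.1 ∧ y.2 = x.2 then (if s then sgn x.1 else 1) else 0 := by
  obtain ⟨a, b⟩ := y
  obtain ⟨c, d⟩ := x
  cases s <;> cases a <;> cases b <;> cases c <;> cases d <;>
    simp [majoranaGate, oddGate, adjugate_bool, majoranaCoeff]

lemma majoranaGate_second_apply (s : Bool) (y x : Bool × Bool) :
    majoranaGate (majoranaCoeff true s) y x =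
      if y.1 = x.1 ∧ y.2 = !x.2 then sgn x.1 * (if s then sgn x.2 else 1) else 0 := by
  obtain ⟨a, b⟩ := y
  obtain ⟨c, d⟩ := x
  cases s <;> cases a <;> cases b <;> cases c <;> cases d <;>
    simp [majoranaGate, oddGate, adjugate_bool, majoranaCoeff]

lemma eq_flipBit_iff_forall (l : Fin M) (y x : Fin M → Bool) :
    y = flipBit l x ↔ y l = (!x l) ∧ ∀ i, i ≠ l → y i = x i := by
  constructor
  · rintro rfl
    exact ⟨flipBit_self l x, fun i hi => flipBit_of_ne hi x⟩
  · rintro ⟨h1, h2⟩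
    funext i
    by_cases hi : i = l
    · rw [hi, h1, flipBit_self]
    · rw [h2 i hi, flipBit_of_ne hi]

lemma jwString_mul_actOn_apply {j k : Fin M} (hjk : (k : ℕ) = j + 1)
    (G : Matrix (Bool × Bool) (Bool × Bool) ℂ) (y x : Fin M → Bool) :
    (jwString j * actOn j k G) y x = if ∀ i, i ≠ j → i ≠ k → y i = x i then
      (∏ i with i < j, sgn (x i)) * G (y j, y k) (x j, x k) else 0 := by
  rw [jwString_mul_actOn hjk, jwString, mul_diagonal, mul_comm]
  simp only [actOn, of_apply, mul_ite, mul_zero]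

/-- Jordan–Wigner locality: up to the string of `Z` operators before `j`, the Majorana operators of
`j` act on the qubits `j` and `k = j + 1` only. -/
lemma majorana_eq_first {j k : Fin M} (hjk : (k : ℕ) = j + 1) (s : Bool) :
    majorana j s = jwString j * actOn j k (majoranaGate (majoranaCoeff false s)) := by
  have hne : k ≠ j := by intro h; rw [h] at hjk; omega
  ext y x
  rw [jwString_mul_actOn_apply hjk, majoranaGate_first_apply, mul_ite, mul_zero, ← ite_and]
  simp only [majorana, of_apply, phase]
  congr 1
  rw [eq_flipBit_iff_forall]
  refine propext ⟨fun ⟨h1, h2⟩ => ⟨fun i hi _ => h2 i hi, h1, h2 k hne⟩,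
    fun ⟨h1, h2, h3⟩ => ⟨h2, fun i hi => ?_⟩⟩
  by_cases h : i = k
  · exact h ▸ h3
  · exact h1 i hi h

/-- For the second qubit `k = j + 1` the factor `Z_j` of its Jordan–Wigner string belongs to the
two-qubit operator. -/
lemma majorana_eq_second {j k : Fin M} (hjk : (k : ℕ) = j + 1) (s : Bool) :
    majorana k s = jwString j * actOn j k (majoranaGate (majoranaCoeff true s)) := by
  have hne : k ≠ j := by intro h; rw [h] at hjk; omega
  have hset :
      (Finset.univ.filter fun i => i < k) = insert j (Finset.univ.filter fun i => i < j) := by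
    ext i
    simp only [Finset.mem_filter_univ, Finset.mem_insert, Fin.lt_def, Fin.ext_iff]
    omega
  ext y x
  rw [jwString_mul_actOn_apply hjk, majoranaGate_second_apply, mul_ite, mul_zero, ← ite_and]
  simp only [majorana, of_apply, phase]
  rw [hset, Finset.prod_insert (by simp), mul_comm (sgn (x j)), mul_assoc]
  congr 1
  rw [eq_flipBit_iff_forall]
  refine propext ⟨fun ⟨h1, h2⟩ => ⟨fun i _ hi => h2 i hi, h2 j hne.symm, h1⟩,
    fun ⟨h1, h2, h3⟩ => ⟨h3, fun i hi => ?_⟩⟩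
  by_cases h : i = j
  · exact h ▸ h2
  · exact h1 i h hi

/-- `majoranaGate` is linear in `P`, because the adjugate of a 2×2 matrix is; the coefficients are the
coordinates of `P` in the basis `majoranaCoeff`. -/
lemma majoranaGate_eq_sum (P : Matrix Bool Bool ℂ) :
    majoranaGate P =
      ((P false true + P true false) / 2) • majoranaGate (majoranaCoeff false false) +
      ((P true false - P false true) / 2) • majoranaGate (majoranaCoeff false true) +
      ((P false false - P true true) / 2) • majoranaGate (majoranaCoeff true false) +
      (-(P false false + P true true) / 2) • majoranaGate (majoranaCoeff true true) := by
  ext ⟨a, b⟩ ⟨c, d⟩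
  cases a <;> cases b <;> cases c <;> cases d <;>
    simp [majoranaGate, oddGate, adjugate_bool, majoranaCoeff] <;> ring

lemma jwString_mul_actOn_mem {j k : Fin M} (hjk : (k : ℕ) = j + 1) (P : Matrix Bool Bool ℂ) :
    jwString j * actOn j k (majoranaGate P) ∈ majoranaSpan M := by
  rw [majoranaGate_eq_sum P]
  simp only [actOn_add, actOn_smul, Matrix.mul_add, Matrix.mul_smul, ← majorana_eq_first hjk,
    ← majorana_eq_second hjk]
  exact add_mem (add_mem (add_mem (Submodule.smul_mem _ _ (majorana_mem _ _))
    (Submodule.smul_mem _ _ (majorana_mem _ _))) (Submodule.smul_mem _ _ (majorana_mem _ _)))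
    (Submodule.smul_mem _ _ (majorana_mem _ _))

/-- A matchgate conjugates a Majorana operator to a linear combination of Majorana operators; stated
without inverses. -/
lemma exists_majorana_mul_operator (g : Gate M) (l : Fin M) (s : Bool) :
    ∃ W ∈ majoranaSpan M, majorana l s * g.operator = g.operator * W := by
  have near : ∀ (j k : Fin M) (hjk : (k : ℕ) = j + 1) (P : Matrix Bool Bool ℂ),
      ∃ W ∈ majoranaSpan M, jwString j * actOn j k (majoranaGate P) *
        actOn j k (matchgate (g.even : Matrix Bool Bool ℂ) (g.odd : Matrix Bool Bool ℂ)) =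
        actOn j k (matchgate (g.even : Matrix Bool Bool ℂ) (g.odd : Matrix Bool Bool ℂ)) * W := by
    intro j k hjk P
    have hne : j ≠ k := by intro h; rw [h] at hjk; omega
    refine ⟨_, jwString_mul_actOn_mem hjk ((g.even : Matrix Bool Bool ℂ).adjugate * P * g.odd), ?_⟩
    rw [Matrix.mul_assoc, actOn_mul hne, majoranaGate_mul_matchgate _ _ _ g.even.2 g.odd.2,
      ← actOn_mul hne, ← Matrix.mul_assoc, jwString_mul_actOn hjk, Matrix.mul_assoc]
  rw [Gate.operator]
  generalize hj : (⟨g.pos, (Nat.lt_succ_self _).trans g.pos_lt⟩ : Fin M) = j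
  generalize hk : (⟨g.pos + 1, g.pos_lt⟩ : Fin M) = k
  have hjk : (k : ℕ) = j + 1 := by simp [← hj, ← hk]
  by_cases h1 : l = j
  · rw [h1, majorana_eq_first hjk]
    exact near j k hjk _
  by_cases h2 : l = k
  · rw [h2, majorana_eq_second hjk]
    exact near j k hjk _
  exact ⟨_, majorana_mem l s, majorana_mul_actOn_of_ne hjk h1 h2 s _ _⟩

/-! ### The acceptance probability is affine in the signs of the input bits -/

/-- Conjugation of a Majorana operator by a matchgate circuit gives a linear combination of Majorana
operators; stated without inverses. -/
lemma exists_mul_operator_of_mem (C : Circuit M) {W : Matrix (Fin M → Bool) (Fin M → Bool) ℂ}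
    (hW : W ∈ majoranaSpan M) :
    ∃ W' ∈ majoranaSpan M, W * Circuit.operator C = Circuit.operator C * W' := by
  induction C generalizing W with
  | nil => exact ⟨W, hW, by simp [Circuit.operator]⟩
  | cons g C ih =>
    obtain ⟨W₁, hW₁, h₁⟩ := ih hW
    suffices h : ∃ W' ∈ majoranaSpan M, W₁ * g.operator = g.operator * W' by
      obtain ⟨W₂, hW₂, h₂⟩ := h
      refine ⟨W₂, hW₂, ?_⟩
      rw [Circuit.operator, ← Matrix.mul_assoc, h₁, Matrix.mul_assoc, h₂, Matrix.mul_assoc]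
    clear h₁
    induction hW₁ using Submodule.span_induction with
    | mem V hV =>
      obtain ⟨p, rfl⟩ := hV
      exact exists_majorana_mul_operator g p.1 p.2
    | zero => exact ⟨0, zero_mem _, by simp⟩
    | add V₁ V₂ _ _ h₁ h₂ =>
      obtain ⟨V₁', m₁, e₁⟩ := h₁
      obtain ⟨V₂', m₂, e₂⟩ := h₂
      exact ⟨V₁' + V₂', add_mem m₁ m₂, by rw [Matrix.add_mul, e₁, e₂, Matrix.mul_add]⟩
    | smul c V _ h =>
      obtain ⟨V', m, e⟩ := h
      exact ⟨c • V', Submodule.smul_mem _ c m, by rw [Matrix.smul_mul, e, Matrix.mul_smul]⟩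

/-- The operators whose diagonal entry at `x` is an affine function of the signs `(-1) ^ x i`. -/
def affineDiag (M : ℕ) : Submodule ℂ (Matrix (Fin M → Bool) (Fin M → Bool) ℂ) where
  carrier := {W | ∃ (a : ℂ) (b : Fin M → ℂ), ∀ x, W x x = a + ∑ i, b i * sgn (x i)}
  zero_mem' := ⟨0, 0, by simp⟩
  add_mem' := by
    rintro V W ⟨a, b, h⟩ ⟨a', b', h'⟩
    refine ⟨a + a', b + b', fun x => ?_⟩
    simp only [Matrix.add_apply, h, h', Pi.add_apply, add_mul, Finset.sum_add_distrib]
    ring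
  smul_mem' := by
    rintro c V ⟨a, b, h⟩
    refine ⟨c * a, c • b, fun x => ?_⟩
    simp only [Matrix.smul_apply, h, Pi.smul_apply, smul_eq_mul, mul_add, Finset.mul_sum, mul_assoc]

/-- The product of two Majorana operators is off-diagonal if they belong to different qubits, and
otherwise the Jordan–Wigner strings cancel. -/
lemma majorana_mul_majorana_mem_affineDiag (k l : Fin M) (s t : Bool) :
    majorana k s * majorana l t ∈ affineDiag M := by
  by_cases hkl : l = k
  · subst hkl
    have key : ∀ x : Fin M → Bool, (majorana l s * majorana l t) x x =
        (if s then -sgn (x l) else 1) * (if t then sgn (x l) else 1) := by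
      intro x
      rw [majorana_mul_apply]
      have hprod : ∏ i with i < l, sgn (flipBit l x i) = ∏ i with i < l, sgn (x i) :=
        Finset.prod_congr rfl fun i hi => by rw [flipBit_of_ne (by simpa using hi : i < l).ne]
      have hsq : (∏ i with i < l, sgn (x i)) * ∏ i with i < l, sgn (x i) = 1 := by
        rw [← Finset.prod_mul_distrib]; simp [sgn_mul_self]
      simp only [majorana, of_apply, if_true, phase, hprod, flipBit_self, sgn_not]
      linear_combination
        (if s then -sgn (x l) else 1) * (if t then sgn (x l) else 1) * hsq
    cases s <;> cases t
    · exact ⟨1, 0, fun x => by simp [key]⟩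
    · exact ⟨0, Pi.single l 1, fun x => by simp [key, Pi.single_apply]⟩
    · exact ⟨0, Pi.single l (-1), fun x => by simp [key, Pi.single_apply]⟩
    · exact ⟨-1, 0, fun x => by simp [key, sgn_mul_self]⟩
  · refine ⟨0, 0, fun x => ?_⟩
    have h : flipBit k x ≠ flipBit l x := fun h => by
      have := congrFun h l
      rw [flipBit_self, flipBit_of_ne hkl] at this
      simp at this
    rw [majorana_mul_apply]
    simp [majorana, h]

lemma mul_mem_affineDiag {V W : Matrix (Fin M → Bool) (Fin M → Bool) ℂ}
    (hV : V ∈ majoranaSpan M) (hW : W ∈ majoranaSpan M) : V * W ∈ affineDiag M := by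
  induction hV using Submodule.span_induction with
  | zero => rw [Matrix.zero_mul]; exact zero_mem _
  | add V₁ V₂ _ _ h₁ h₂ => rw [Matrix.add_mul]; exact add_mem h₁ h₂
  | smul c V _ h => rw [Matrix.smul_mul]; exact Submodule.smul_mem _ c h
  | mem V hV =>
    obtain ⟨p, rfl⟩ := hV
    induction hW using Submodule.span_induction with
    | zero => rw [Matrix.mul_zero]; exact zero_mem _
    | add V₁ V₂ _ _ h₁ h₂ => rw [Matrix.mul_add]; exact add_mem h₁ h₂
    | smul c V _ h => rw [Matrix.mul_smul]; exact Submodule.smul_mem _ c h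
    | mem W hW =>
      obtain ⟨q, rfl⟩ := hW
      exact majorana_mul_majorana_mem_affineDiag _ _ _ _

/-- The Pauli `Z` operator of qubit `i`. -/
def pauliZ (i : Fin M) : Matrix (Fin M → Bool) (Fin M → Bool) ℂ := diagonal fun x => sgn (x i)

lemma majorana_mul_majorana_self (i : Fin M) : majorana i false * majorana i true = pauliZ i := by
  ext y x
  rw [majorana_mul_apply, pauliZ, diagonal_apply]
  by_cases h : y = x
  · subst h
    have hprod : ∏ l with l < i, sgn (flipBit i y l) = ∏ l with l < i, sgn (y l) :=
      Finset.prod_congr rfl fun l hl => by rw [flipBit_of_ne (by simpa using hl : l < i).ne]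
    have hsq : (∏ l with l < i, sgn (y l)) * ∏ l with l < i, sgn (y l) = 1 := by
      rw [← Finset.prod_mul_distrib]; simp [sgn_mul_self]
    simp only [majorana, of_apply, if_true, phase, hprod]
    simp only [Bool.false_eq_true, if_false]
    linear_combination sgn (y i) * hsq
  · have h' : flipBit i y ≠ flipBit i x := fun e =>
      h (by rw [← flipBit_flipBit i y, e, flipBit_flipBit])
    simp [majorana, h, h']

lemma conjTranspose_mul_pauliZ_mul_mem (C : Circuit M) (i : Fin M) :
    (Circuit.operator C)ᴴ * pauliZ i * Circuit.operator C ∈ affineDiag M := by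
  obtain ⟨V, hV, eV⟩ := exists_mul_operator_of_mem C (majorana_mem i false)
  obtain ⟨W, hW, eW⟩ := exists_mul_operator_of_mem C (majorana_mem i true)
  rw [← majorana_mul_majorana_self, Matrix.mul_assoc, Matrix.mul_assoc, eW,
    ← Matrix.mul_assoc (majorana i false), eV, ← Matrix.mul_assoc, ← Matrix.mul_assoc,
    C.conjTranspose_operator_mul_self, Matrix.one_mul]
  exact mul_mem_affineDiag hV hW

lemma outcomeProb_false_add_true (C : Circuit M) (z : Fin M → Bool) (i : Fin M) :
    outcomeProb C z i false + outcomeProb C z i true = 1 := by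
  have h := congrFun (congrFun C.conjTranspose_operator_mul_self z) z
  rw [one_apply_eq, mul_apply] at h
  rw [outcomeProb, outcomeProb, ← Finset.sum_add_distrib, ← Complex.ofReal_inj]
  push_cast
  rw [← h]
  refine Finset.sum_congr rfl fun y _ => ?_
  rw [conjTranspose_apply, Complex.star_def, Complex.conj_mul']
  cases y i <;> simp

lemma outcomeProb_false_sub_true (C : Circuit M) (z : Fin M → Bool) (i : Fin M) :
    ((outcomeProb C z i false - outcomeProb C z i true : ℝ) : ℂ) =
      ((Circuit.operator C)ᴴ * pauliZ i * Circuit.operator C) z z := by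
  rw [Matrix.mul_assoc, mul_apply, outcomeProb, outcomeProb, ← Finset.sum_sub_distrib]
  push_cast
  refine Finset.sum_congr rfl fun y _ => ?_
  rw [pauliZ, diagonal_mul, conjTranspose_apply, Complex.star_def, mul_left_comm,
    Complex.conj_mul']
  cases y i <;> simp

/-- The difference of the two outcome probabilities is an affine function of the signs of the input
bits. -/
theorem exists_outcomeProb_eq_affine (C : Circuit M) (i : Fin M) :
    ∃ (a : ℂ) (b : Fin M → ℂ), ∀ z : Fin M → Bool,
      ((outcomeProb C z i false - outcomeProb C z i true : ℝ) : ℂ) = a + ∑ l, b l * sgn (z l) := by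
  obtain ⟨a, b, h⟩ := conjTranspose_mul_pauliZ_mul_mem C i
  exact ⟨a, b, fun z => by rw [outcomeProb_false_sub_true, h]⟩

/-! ### Parity is not matchgate-computable -/

/-- The parity of a bit string. -/
def parity (n : ℕ) (x : Fin n → Bool) : Bool := (List.ofFn x).foldl xor false

theorem not_efficientlyMatchgateComputable_parity : ¬ EfficientlyMatchgateComputable parity := by
  rintro ⟨M, hM, U, -, -, h⟩
  -- On two bits the signed bias `d` satisfies `d 00 + d 11 = d 01 + d 10`, being affine in the
  -- signs, whereas correctness makes the left side at least `2/3` and the right at most `-2/3`.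
  specialize h 2 one_le_two
  set o : Fin (M 2) := ⟨0, one_le_two.trans (hM 2 one_le_two)⟩
  obtain ⟨a, b, hab⟩ := exists_outcomeProb_eq_affine (U 2) o
  let d : Bool → Bool → ℝ := fun p q =>
    outcomeProb (U 2) (pad (M 2) ![p, q]) o false - outcomeProb (U 2) (pad (M 2) ![p, q]) o true
  have hd : d false false + d true true = d false true + d true false := by
    rw [← Complex.ofReal_inj]
    push_cast
    simp only [d, hab]
    rw [add_add_add_comm, add_add_add_comm a _ a, ← Finset.sum_add_distrib,
      ← Finset.sum_add_distrib]
    congr 1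
    refine Finset.sum_congr rfl fun l _ => ?_
    obtain ⟨l, hl⟩ := l
    match l with
    | 0 => simp [pad]
    | 1 => simp [pad]
    | l + 2 => simp [pad]
  have h00 := h ![false, false]
  have h11 := h ![true, true]
  have h01 := h ![false, true]
  have h10 := h ![true, false]
  have s00 := outcomeProb_false_add_true (U 2) (pad (M 2) ![false, false]) o
  have s11 := outcomeProb_false_add_true (U 2) (pad (M 2) ![true, true]) o
  have s01 := outcomeProb_false_add_true (U 2) (pad (M 2) ![false, true]) o
  have s10 := outcomeProb_false_add_true (U 2) (pad (M 2) ![true, false]) o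
  simp only [parity, List.ofFn_succ, List.ofFn_zero, List.foldl_cons, List.foldl_nil,
    Matrix.cons_val_zero, Matrix.cons_val_succ, Bool.xor_false, Bool.xor_true, Bool.not_false,
    Bool.not_true] at h00 h11 h01 h10
  simp only [d] at hd
  linarith

/-! ### Parity is in P -/

/-- A one-stack machine that pops the input, keeping in its finite memory the bit popped last and
the parity so far; on the empty stack it pushes the parity, clears its memory and halts. -/
def parityMachine : Turing.FinTM2 where
  K := Unit
  k₀ := ()
  k₁ := ()
  Γ _ := Bool
  Λ := Unit
  main := ()
  σ := Option Bool × Bool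
  initialState := (none, false)
  m _ := .pop () (fun v a => (a, xor v.2 (a.getD false)))
    (.branch (fun v => v.1.isSome) (.goto fun _ => ())
      (.push () (fun v => v.2) (.load (fun _ => (none, false)) .halt)))

/-- The configuration of `parityMachine` with label `l`, memory `v` and stack `w`. -/
def parityCfg (l : Option Unit) (v : Option Bool × Bool) (w : List Bool) : parityMachine.Cfg :=
  Turing.TM2.Cfg.mk l v fun _ => w

lemma parityMachine_step_nil (o : Option Bool) (acc : Bool) :
    parityMachine.step (parityCfg (some ()) (o, acc) []) =
      some (parityCfg none (none, false) [acc]) := by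
  cases acc <;> rfl

lemma parityMachine_step_cons (o : Option Bool) (acc b : Bool) (w : List Bool) :
    parityMachine.step (parityCfg (some ()) (o, acc) (b :: w)) =
      some (parityCfg (some ()) (some b, xor acc b) w) := rfl

lemma parityMachine_iterate (w : List Bool) (o : Option Bool) (acc : Bool) :
    (flip bind parityMachine.step)^[w.length + 1] (some (parityCfg (some ()) (o, acc) w)) =
      some (parityCfg none (none, false) [w.foldl xor acc]) := by
  induction w generalizing o acc with
  | nil => exact parityMachine_step_nil o acc
  | cons b w ih =>
    rw [List.length_cons, Function.iterate_succ_apply, List.foldl_cons, ← ih (some b)]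
    exact congrArg _ (parityMachine_step_cons o acc b w)

theorem inP_parity : InP parity := by
  -- One step per popped bit and one to find the stack empty.
  refine ⟨{ tm := parityMachine
            inputAlphabet := Equiv.refl Bool
            outputAlphabet := Equiv.refl Bool
            time := Polynomial.X + 1
            outputsFun := fun w => ⟨⟨w.length + 1, ?_⟩, ?_⟩ }⟩
  · have hmap : List.map (Equiv.refl Bool).invFun w = w := List.map_id w
    have hpar : parity w.length w.get = w.foldl xor false := by rw [parity, List.ofFn_get]
    rw [hpar]
    exact (congrArg (fun v : List Bool => (flip bind parityMachine.step)^[w.length + 1]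
      (some (Turing.initList parityMachine v))) hmap).trans (parityMachine_iterate w none false)
  · simp [Computability.encodingList]

end MatchgateCircuit

theorem theorem4 :
    ∃ f : (n : ℕ) → (Fin n → Bool) → Bool,
      MatchgateCircuit.InP f ∧ ¬ MatchgateCircuit.EfficientlyMatchgateComputable f :=
  ⟨MatchgateCircuit.parity, MatchgateCircuit.inP_parity,
    MatchgateCircuit.not_efficientlyMatchgateComputable_parity⟩
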